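/- Let $X$ be a complete separable metric space with Borel $\sigma$-algebra $\mathcal A$. A measure on $(X,\mathcal A)$ is \emph{boundedly finite} if it is finite on bounded Borel sets. Let $\widetilde X$ be the space of boundedly finite measures on $X$, with the $\sigma$-algebra $\widetilde{\mathcal A}$ generated by the maps $\xi\mapsto\xi(A)$, $A\in\mathcal A$ (equivalently, its Borel $\sigma$-algebra), and let $\widetilde X_d\subset\widetilde X$ be the set of discrete measures, i.e. those carried by a countable set. Let $\mu$ be a boundedly finite, continuous (atomless) measure on $X$ with $\mu(X)=\infty$, and let $T$ be an invertible bimeasurable transformation of $X$ which preserves $\mu$ and is conservative and ergodic. Put $T_*\xi(A)=\xi(T^{-1}A)$. (As $T_*\xi$ need not be boundedly finite, $T_*$-invariance of a measure on $\widetilde X$ means invariance as a measure on the space of all measures on $X$.) Let $m$ be a probability measure on $\widetilde X$ such that - $m$ is $T_*$-invariant and ergodic; - $\int\xi(B)^2\,m(d\xi)<\infty$ for every bounded $B\in\mathcal A$ (square integrability); - $m$ is infinitely divisible: for every $k\ge 1$ it is the distribution of the sum of $k$ independent random elements of $\widetilde X$ with a common distribution; - $m$ has intensity $\mu$: $\int\xi(A)\,m(d\xi)=\mu(A)$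 for all $A\in\mathcal A$; - $m$-almost every $\xi$ is discrete. Suppose that $m$ is represented by $(\gamma,\rho)$, that is, $\gamma\in\widetilde X$, $\rho$ is a $\sigma$-finite measure on $\widetilde X\setminus\{0\}$ (regarded as a measure on $\widetilde X$ with $\rho(\{0\})=0$) with $\int(\xi(B)\wedge 1)\,\rho(d\xi)<\infty$ for all bounded $B\in\mathcal A$, and $m$ is the distribution of the random measure $\gamma+\int\xi(\cdot)\,\omega(d\xi)$, where $\omega$ is a Poisson point process on $\widetilde X$ with intensity $\rho$. Then: 1. $\gamma=0$; 2. $\rho$ is $T_*$-invariant and supported by $\widetilde X_d$, i.e. $\rho(\widetilde X\setminus\widetilde X_d)=0$; 3. $\int\xi(A)\,\rho(d\xi)=\mu(A)$ for all $A\in\mathcal A$ with $\mu(A)<\infty$; 4. $\int\xi(A)^2\,\rho(d\xi)=\int(\xi(A)-\mu(A))^2\,m(d\xi)$, as an equality in $[0,\infty]$, for all $A\in\mathcal A$ with $\mu(A)<\infty$; 5. $(\widetilde X,\widetilde{\mathcal A},\rho,T_*)$ has no invariant set of finite nonzero measure: if $K$ is measurable, $T_*^{-1}K=K$ up to a $\rho$-null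 set and $\rho(K)<\infty$, then $\rho(K)=0$. -/

import Mathlib

open MeasureTheory ProbabilityTheory
open scoped ENNReal

/-- `ξ` is boundedly finite: it gives finite mass to every bounded Borel set. The space of boundedly
finite measures is the set of all `ξ : Measure X` with this property, with the σ-algebra generated
by the evaluations `ξ ↦ ξ A` (the one that `Measure X` carries in Mathlib). It is a measurable
subset of `Measure X` (`measurableSet_boundedlyFinite` below), so a measure on this space is the
same thing as a measure on `Measure X` for which almost every `ξ` is boundedly finite. -/
def BoundedlyFinite {X : Type*} [PseudoMetricSpace X] [MeasurableSpace X] (ξ : Measure X) : Prop :=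
  ∀ B : Set X, MeasurableSet B → Bornology.IsBounded B → ξ B < ∞

theorem measurableSet_boundedlyFinite {X : Type*} [PseudoMetricSpace X] [MeasurableSpace X]
    [BorelSpace X] : MeasurableSet {ξ : Measure X | BoundedlyFinite ξ} := by
  rcases isEmpty_or_nonempty X with hX | ⟨⟨x⟩⟩
  · have h : {ξ : Measure X | BoundedlyFinite ξ} = Set.univ := by
      ext ξ
      simp [BoundedlyFinite, Set.eq_empty_of_isEmpty]
    rw [h]
    exact MeasurableSet.univ
  · have h : {ξ : Measure X | BoundedlyFinite ξ}
        = ⋂ n : ℕ, {ξ : Measure X | ξ (Metric.ball x n) < ∞} := by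
      ext ξ
      simp only [Set.mem_ofPred_eq, Set.mem_iInter]
      constructor
      · intro h n
        exact h _ Metric.isOpen_ball.measurableSet Metric.isBounded_ball
      · intro h B _ hb
        obtain ⟨r, hr⟩ := hb.subset_ball x
        obtain ⟨n, hn⟩ := exists_nat_ge r
        exact (measure_mono (hr.trans (Metric.ball_subset_ball hn))).trans_lt (h n)
    rw [h]
    exact MeasurableSet.iInter fun n =>
      measurableSet_lt (Measure.measurable_coe Metric.isOpen_ball.measurableSet) measurable_const

/-- `ξ` is discrete (purely atomic): it is carried by a countable set. -/
def DiscreteMeasure {X : Type*} [MeasurableSpace X] (ξ : Measure X) : Prop :=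
  ∃ S : Set X, S.Countable ∧ ξ Sᶜ = 0

/-- The transformation `T_*` of the space of measures, `T_* ξ (A) = ξ (T⁻¹ A)`. -/
noncomputable def pushMeasure {X : Type*} [MeasurableSpace X] (T : X ≃ᵐ X) (ξ : Measure X) :
    Measure X :=
  ξ.map T

/-- `ω` is a counting measure: a finite or countable sum of Dirac masses. -/
def CountingMeasure {E : Type*} [MeasurableSpace E] (ω : Measure E) : Prop :=
  ∃ (I : Set ℕ) (x : I → E), ω = Measure.sum fun i : I => Measure.dirac (x i)

/-- `P` is the distribution of a Poisson point process on `E` with intensity `ρ`: a random counting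
measure whose values on sets of finite `ρ`-measure are Poisson distributed with the `ρ`-measures as
parameters, and independent for disjoint sets. -/
structure IsPoissonLaw {E : Type*} [MeasurableSpace E] (ρ : Measure E) (P : Measure (Measure E)) :
    Prop where
  isProbabilityMeasure : IsProbabilityMeasure P
  counting : ∀ᵐ ω ∂P, CountingMeasure ω
  poisson : ∀ A : Set E, MeasurableSet A → ρ A < ∞ →
    P.map (fun ω => ω A) = (poissonMeasure (ρ A).toNNReal).map (fun k : ℕ => (k : ℝ≥0∞))
  indep : ∀ (n : ℕ) (A : Fin n → Set E), (∀ i, MeasurableSet (A i)) → (∀ i, ρ (A i) < ∞) →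
    Pairwise (Function.onFun Disjoint A) → iIndepFun (fun i (ω : Measure E) => ω (A i)) P

/-- `m` is infinitely divisible: for every `k ≥ 1`, it is the distribution of the sum of `k`
independent random boundedly finite measures with a common distribution. -/
def InfinitelyDivisible {X : Type*} [PseudoMetricSpace X] [MeasurableSpace X]
    (m : Measure (Measure X)) : Prop :=
  ∀ k : ℕ, 1 ≤ k → ∃ σ : Measure (Measure X), IsProbabilityMeasure σ ∧
    (∀ᵐ ξ ∂σ, BoundedlyFinite ξ) ∧
    m = (Measure.pi fun _ : Fin k => σ).map fun ξ => ∑ i, ξ i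

/-- `m` corresponds to `(γ, ρ)` in the Lévy–Khinchine representation of infinitely divisible random
measures: `γ` is a boundedly finite measure on `X`, `ρ` is a σ-finite measure on the space of nonzero
boundedly finite measures with `∫ min (ξ B) 1 ρ(dξ) < ∞` for bounded `B`, and `m` is the distribution
of the random measure `γ + ∫ ξ ω(dξ)`, where `ω` is a Poisson process with intensity `ρ`.
(`Measure.join ω` is the measure `A ↦ ∫ ξ A ω(dξ)`.) -/
structure HasLevyRepresentation {X : Type*} [PseudoMetricSpace X] [MeasurableSpace X]
    (m : Measure (Measure X)) (γ : Measure X) (ρ : Measure (Measure X)) : Prop where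
  drift : BoundedlyFinite γ
  sigmaFinite : SigmaFinite ρ
  carrier : ∀ᵐ ξ ∂ρ, BoundedlyFinite ξ ∧ ξ ≠ 0
  integrability : ∀ B : Set X, MeasurableSet B → Bornology.IsBounded B →
    ∫⁻ ξ, min (ξ B) 1 ∂ρ < ∞
  law : ∃ P : Measure (Measure (Measure X)), IsPoissonLaw ρ P ∧
    m = P.map fun ω => γ + Measure.join ω

/-! Let `ω` be the Poisson process with intensity `ρ`. The drift vanishes because `γ ≤ μ` is
atomless while `γ` is also dominated by a discrete realisation of the random measure
(`IsPoissonLaw.drift_eq_zero`). Hence `m` is the law of `Measure.join ω`, and the claims follow from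
the formulas for Poisson integrals. Campbell's formula gives `∫ ξ A dρ = μ A`, and the second moment
formula identifies `∫ ξ(A)² dρ` with the variance under `m`. Each point of `ω` is a measure
dominated by `join ω`, hence discrete; Campbell's formula turns this into a statement about
`ρ`-almost every `ξ`.

Invariance and the absence of finite invariant sets rest on the Laplace functional `E exp(-∫ g dω) =
exp(-∫ (1 - exp(-g)) dρ)`. The exponent `f ↦ ∫ (1 - exp(-∫ f dξ)) dρ` determines `ρ` on nonzero
measures (`ext_of_lintegral_one_sub_expNeg`), so invariance of `m` passes to `ρ`.

For an invariant `K` with `ρ K < ∞`, the event `ω K = 0` need not be a function of `join ω`. Instead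
one takes the law of `join ω` restricted to this event: it is `T_*`-invariant and absolutely
continuous with respect to `m`, hence `c • m` by ergodicity. Comparing Laplace functionals gives `c
= exp(-ρ K)` and then `∫_K (1 - exp(-∫ w dξ)) dρ = 0` for a strictly positive `w`, which forces `ρ K
= 0`. -/

/-! ### The exponential on `[0, ∞]`. -/

/-- The function `x ↦ exp (-x)` on `[0, ∞]`. -/
noncomputable def ENNReal.expNeg (x : ℝ≥0∞) : ℝ≥0∞ := EReal.exp (-(x : EReal))

namespace ENNReal

@[simp] theorem expNeg_zero : expNeg 0 = 1 := by simp [expNeg]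

@[simp] theorem expNeg_top : expNeg ∞ = 0 := by simp [expNeg]

theorem expNeg_ofReal {r : ℝ} (hr : 0 ≤ r) :
    expNeg (ENNReal.ofReal r) = ENNReal.ofReal (Real.exp (-r)) := by
  rw [expNeg, EReal.coe_ennreal_ofReal, max_eq_left hr, ← EReal.coe_neg, EReal.exp_coe]

theorem expNeg_strictAnti : StrictAnti expNeg := fun x y h => by
  simpa [expNeg] using h

theorem expNeg_injective : Function.Injective expNeg := expNeg_strictAnti.injective

theorem continuous_expNeg : Continuous expNeg :=
  ENNReal.continuous_exp.comp (continuous_neg.comp continuous_coe_ennreal_ereal)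

theorem measurable_expNeg : Measurable expNeg := continuous_expNeg.measurable

theorem expNeg_le_one (x : ℝ≥0∞) : expNeg x ≤ 1 := by
  rw [← expNeg_zero]
  exact expNeg_strictAnti.antitone zero_le

theorem expNeg_ne_top (x : ℝ≥0∞) : expNeg x ≠ ∞ := ne_top_of_le_ne_top one_ne_top (expNeg_le_one x)

theorem expNeg_add (x y : ℝ≥0∞) : expNeg (x + y) = expNeg x * expNeg y := by
  rw [expNeg, EReal.coe_ennreal_add, EReal.neg_add (by simp) (by simp), sub_eq_add_neg,
    EReal.exp_add, expNeg, expNeg]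

theorem expNeg_sum {ι : Type*} (s : Finset ι) (f : ι → ℝ≥0∞) :
    expNeg (∑ i ∈ s, f i) = ∏ i ∈ s, expNeg (f i) := by
  classical
  induction s using Finset.induction_on with
  | empty => simp
  | insert i s hi ih => rw [Finset.sum_insert hi, Finset.prod_insert hi, expNeg_add, ih]

theorem expNeg_mul_natCast (x : ℝ≥0∞) (n : ℕ) : expNeg (x * n) = expNeg x ^ n := by
  have := expNeg_sum (Finset.range n) fun _ => x
  simpa [mul_comm] using this

theorem one_sub_expNeg_le (x : ℝ≥0∞) : 1 - expNeg x ≤ x := by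
  rcases eq_or_ne x ∞ with rfl | hx
  · simp
  · rw [← ofReal_toReal hx, expNeg_ofReal toReal_nonneg, ← ofReal_one,
      ← ofReal_sub _ (Real.exp_pos _).le]
    apply ofReal_le_ofReal
    linarith [Real.add_one_le_exp (-x.toReal)]

theorem one_sub_expNeg_eq_zero {x : ℝ≥0∞} : 1 - expNeg x = 0 ↔ x = 0 := by
  rw [tsub_eq_zero_iff_le, ← expNeg_zero, expNeg_strictAnti.le_iff_ge, nonpos_iff_eq_zero]

/-- Used to obtain the Laplace functional of a weighted Lévy measure as an increment of the
exponent. -/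
theorem one_sub_expNeg_add (x y : ℝ≥0∞) :
    1 - expNeg (x + y) = (1 - expNeg x) + expNeg x * (1 - expNeg y) := by
  rw [ENNReal.mul_sub fun _ _ => expNeg_ne_top x, mul_one, expNeg_add,
    tsub_add_tsub_cancel (expNeg_le_one x) (mul_le_of_le_one_right' (expNeg_le_one y))]

theorem monotone_one_sub_expNeg : Monotone fun x => 1 - expNeg x := fun _ _ h =>
  tsub_le_tsub_left (expNeg_strictAnti.antitone h) 1

theorem continuous_one_sub_expNeg : Continuous fun x => 1 - expNeg x :=
  (ENNReal.continuous_sub_left one_ne_top).comp continuous_expNeg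

theorem measurable_one_sub_expNeg : Measurable fun x => 1 - expNeg x :=
  continuous_one_sub_expNeg.measurable

end ENNReal

/-! ### Moments and Laplace transform of the Poisson distribution. -/

namespace ProbabilityTheory

theorem lintegral_poissonMeasure (r : NNReal) (f : ℕ → ℝ≥0∞) :
    ∫⁻ n, f n ∂poissonMeasure r
      = ∑' n : ℕ, ENNReal.ofReal (Real.exp (-r) * r ^ n / n.factorial) * f n := by
  rw [poissonMeasure, lintegral_sum_measure]
  simp

/-- The Stein–Chen identity for the Poisson distribution. -/
theorem lintegral_natCast_mul_poissonMeasure (r : NNReal) (f : ℕ → ℝ≥0∞) :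
    ∫⁻ n, n * f n ∂poissonMeasure r = r * ∫⁻ n, f (n + 1) ∂poissonMeasure r := by
  rw [lintegral_poissonMeasure, lintegral_poissonMeasure, tsum_eq_zero_add' ENNReal.summable,
    ← ENNReal.tsum_mul_left]
  simp only [Nat.cast_zero, zero_mul, mul_zero, zero_add]
  congr 1 with n
  rw [← mul_assoc, ← mul_assoc]
  congr 1
  rw [← ENNReal.ofReal_natCast, ← ENNReal.ofReal_mul (by positivity),
    ← ENNReal.ofReal_coe_nnreal (p := r), ← ENNReal.ofReal_mul (by positivity)]
  congr 1
  rw [Nat.factorial_succ]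
  push_cast
  field_simp
  exact pow_succ' _ _

theorem lintegral_natCast_poissonMeasure (r : NNReal) :
    ∫⁻ n, (n : ℝ≥0∞) ∂poissonMeasure r = r := by
  simpa using lintegral_natCast_mul_poissonMeasure r fun _ => 1

theorem lintegral_natCast_sq_poissonMeasure (r : NNReal) :
    ∫⁻ n, (n : ℝ≥0∞) * n ∂poissonMeasure r = r + r * r := by
  rw [lintegral_natCast_mul_poissonMeasure r fun n => (n : ℝ≥0∞)]
  simp only [Nat.cast_add, Nat.cast_one]
  rw [lintegral_add_right _ measurable_const, lintegral_natCast_poissonMeasure]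
  simp [mul_add, add_comm]

/-- The generating function at `q = expNeg c`. The value `c = ∞` is allowed and gives the
probability of `0`, since `∞ * 0 = 0`. -/
theorem lintegral_expNeg_poissonMeasure (r : NNReal) (c : ℝ≥0∞) :
    ∫⁻ n, ENNReal.expNeg (c * n) ∂poissonMeasure r
      = ENNReal.expNeg (r * (1 - ENNReal.expNeg c)) := by
  obtain ⟨q, hq⟩ : ∃ q : NNReal, (q : ℝ≥0∞) = ENNReal.expNeg c :=
    ⟨_, ENNReal.coe_toNNReal (ENNReal.expNeg_ne_top c)⟩
  have hq1 : (q : ℝ) ≤ 1 := by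
    have := ENNReal.expNeg_le_one c
    rw [← hq] at this
    exact_mod_cast this
  have hsum : HasSum (fun n : ℕ => Real.exp (-r) * r ^ n / n.factorial * (q : ℝ) ^ n)
      (Real.exp (-r) * Real.exp (r * q)) := by
    have := (NormedSpace.expSeries_div_hasSum_exp ((r : ℝ) * q)).mul_left (Real.exp (-r))
    rw [← Real.exp_eq_exp_ℝ] at this
    refine this.congr_fun ?_
    intro n
    rw [mul_pow]; ring
  rw [lintegral_poissonMeasure]
  simp only [ENNReal.expNeg_mul_natCast, ← hq]
  have h1 : (r : ℝ≥0∞) * (1 - q) = ENNReal.ofReal (r * (1 - q)) := by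
    rw [ENNReal.ofReal_mul (by positivity), ENNReal.ofReal_sub _ (by positivity)]
    simp
  have h3 : (0 : ℝ) ≤ r * (1 - q) := mul_nonneg r.2 (by linarith)
  rw [h1, ENNReal.expNeg_ofReal h3]
  have h2 : Real.exp (-(r * (1 - q))) = Real.exp (-r) * Real.exp (r * q) := by
    rw [← Real.exp_add]; congr 1; ring
  rw [h2, ← hsum.tsum_eq, ENNReal.ofReal_tsum_of_nonneg (fun n => by positivity) hsum.summable]
  congr 1 with n
  rw [ENNReal.ofReal_mul (p := Real.exp (-r) * r ^ n / n.factorial) (by positivity),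
    ENNReal.ofReal_pow (NNReal.coe_nonneg q)]
  simp

end ProbabilityTheory

/-! ### Moments and Laplace functional of a Poisson process. -/

namespace MeasureTheory.Measure

/-- Two measures coincide as soon as they coincide on the sets to which a `σ`-finite measure gives
finite mass. -/
theorem ext_of_forall_measure_lt_top {E : Type*} [MeasurableSpace E] (ρ : Measure E)
    [SigmaFinite ρ] {ν₁ ν₂ : Measure E}
    (h : ∀ A, MeasurableSet A → ρ A < ∞ → ν₁ A = ν₂ A) : ν₁ = ν₂ := by
  ext A hA
  have hmono : Monotone fun n => A ∩ spanningSets ρ n := fun i j hij =>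
    Set.inter_subset_inter_right _ (monotone_spanningSets ρ hij)
  have hU : ⋃ n, A ∩ spanningSets ρ n = A := by
    rw [← Set.inter_iUnion, iUnion_spanningSets, Set.inter_univ]
  rw [← hU, hmono.measure_iUnion, hmono.measure_iUnion]
  congr 1 with n
  exact h _ (hA.inter (measurableSet_spanningSets ρ n))
    ((measure_mono Set.inter_subset_right).trans_lt (measure_spanningSets_lt_top ρ n))

end MeasureTheory.Measure

namespace IsPoissonLaw

variable {E : Type*} [MeasurableSpace E] {ρ : Measure E} {P : Measure (Measure E)}

theorem lintegral_comp_apply (hP : IsPoissonLaw ρ P) {A : Set E} (hA : MeasurableSet A)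
    (hρA : ρ A < ∞) {h : ℝ≥0∞ → ℝ≥0∞} (hh : Measurable h) :
    ∫⁻ ω, h (ω A) ∂P = ∫⁻ k : ℕ, h k ∂poissonMeasure (ρ A).toNNReal := by
  rw [← lintegral_map hh (Measure.measurable_coe hA), hP.poisson A hA hρA,
    lintegral_map hh (measurable_of_countable _)]

theorem lintegral_apply (hP : IsPoissonLaw ρ P) {A : Set E} (hA : MeasurableSet A)
    (hρA : ρ A < ∞) : ∫⁻ ω, ω A ∂P = ρ A := by
  refine (hP.lintegral_comp_apply hA hρA measurable_id).trans ?_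
  exact (lintegral_natCast_poissonMeasure _).trans (ENNReal.coe_toNNReal hρA.ne)

theorem lintegral_apply_sq (hP : IsPoissonLaw ρ P) {A : Set E} (hA : MeasurableSet A)
    (hρA : ρ A < ∞) : ∫⁻ ω, ω A * ω A ∂P = ρ A + ρ A * ρ A := by
  rw [hP.lintegral_comp_apply hA hρA (h := fun x => x * x) (by fun_prop),
    lintegral_natCast_sq_poissonMeasure, ENNReal.coe_toNNReal hρA.ne]

theorem lintegral_expNeg_mul_apply (hP : IsPoissonLaw ρ P) {A : Set E} (hA : MeasurableSet A)
    (hρA : ρ A < ∞) (c : ℝ≥0∞) :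
    ∫⁻ ω, ENNReal.expNeg (c * ω A) ∂P = ENNReal.expNeg (ρ A * (1 - ENNReal.expNeg c)) := by
  rw [hP.lintegral_comp_apply hA hρA (h := fun x => ENNReal.expNeg (c * x))
    (ENNReal.measurable_expNeg.comp (by fun_prop)), lintegral_expNeg_poissonMeasure,
    ENNReal.coe_toNNReal hρA.ne]

theorem lintegral_apply_mul_apply_of_disjoint (hP : IsPoissonLaw ρ P) {A B : Set E}
    (hA : MeasurableSet A) (hB : MeasurableSet B) (hρA : ρ A < ∞) (hρB : ρ B < ∞)
    (hAB : Disjoint A B) : ∫⁻ ω, ω A * ω B ∂P = ρ A * ρ B := by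
  have h := hP.indep 2 ![A, B] (by simp [Fin.forall_fin_two, hA, hB])
    (by simp [Fin.forall_fin_two, hρA, hρB])
    (by
      intro i j hij
      fin_cases i <;> fin_cases j <;> simp_all [Function.onFun, disjoint_comm])
  have h01 : IndepFun (fun ω : Measure E => ω A) (fun ω => ω B) P :=
    h.indepFun (show (0 : Fin 2) ≠ 1 by decide)
  have := lintegral_mul_eq_lintegral_mul_lintegral_of_indepFun
    (Measure.measurable_coe hA) (Measure.measurable_coe hB) h01
  simp only [Pi.mul_apply] at this
  rw [this, hP.lintegral_apply hA hρA, hP.lintegral_apply hB hρB]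

theorem lintegral_apply_mul_apply (hP : IsPoissonLaw ρ P) {A B : Set E}
    (hA : MeasurableSet A) (hB : MeasurableSet B) (hρA : ρ A < ∞) (hρB : ρ B < ∞) :
    ∫⁻ ω, ω A * ω B ∂P = ρ (A ∩ B) + ρ A * ρ B := by
  have hI := hA.inter hB
  have hAd := hA.diff hB
  have hBd := hB.diff hA
  have hρI : ρ (A ∩ B) < ∞ := (measure_mono Set.inter_subset_left).trans_lt hρA
  have hρAd : ρ (A \ B) < ∞ := (measure_mono Set.sdiff_subset).trans_lt hρA
  have hρBd : ρ (B \ A) < ∞ := (measure_mono Set.sdiff_subset).trans_lt hρB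
  have hsplitA (ω : Measure E) : ω A = ω (A ∩ B) + ω (A \ B) :=
    (measure_inter_add_sdiff A hB).symm
  have hsplitB (ω : Measure E) : ω B = ω (A ∩ B) + ω (B \ A) := by
    rw [Set.inter_comm]; exact (measure_inter_add_sdiff B hA).symm
  have hm {S : Set E} (hS : MeasurableSet S) : Measurable fun ω : Measure E => ω S :=
    Measure.measurable_coe hS
  have hexp (ω : Measure E) : ω A * ω B = ω (A ∩ B) * ω (A ∩ B) + ω (A ∩ B) * ω (B \ A)
      + (ω (A \ B) * ω (A ∩ B) + ω (A \ B) * ω (B \ A)) := by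
    rw [hsplitA, hsplitB]; ring
  simp_rw [hexp]
  have hm2 {S S' : Set E} (hS : MeasurableSet S) (hS' : MeasurableSet S') :
      Measurable fun ω : Measure E => ω S * ω S' := (hm hS).mul (hm hS')
  have hm4 : Measurable fun ω : Measure E => ω (A \ B) * ω (A ∩ B) + ω (A \ B) * ω (B \ A) :=
    (hm2 hAd hI).add (hm2 hAd hBd)
  rw [lintegral_add_right _ hm4,
    lintegral_add_left (hm2 hI hI), lintegral_add_left (hm2 hAd hI),
    hP.lintegral_apply_sq hI hρI,
    hP.lintegral_apply_mul_apply_of_disjoint hI hBd hρI hρBd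
      (Set.disjoint_sdiff_right.mono_left Set.inter_subset_left),
    hP.lintegral_apply_mul_apply_of_disjoint hAd hI hρAd hρI
      (Set.disjoint_sdiff_left.mono_right Set.inter_subset_right),
    hP.lintegral_apply_mul_apply_of_disjoint hAd hBd hρAd hρBd disjoint_sdiff_sdiff]
  ring

theorem lintegral_expNeg_sum (hP : IsPoissonLaw ρ P) {n : ℕ} (A : Fin n → Set E)
    (hA : ∀ i, MeasurableSet (A i)) (hρA : ∀ i, ρ (A i) < ∞)
    (hdisj : Pairwise (Function.onFun Disjoint A)) (c : Fin n → ℝ≥0∞) :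
    ∫⁻ ω, ENNReal.expNeg (∑ i, c i * ω (A i)) ∂P
      = ENNReal.expNeg (∑ i, (1 - ENNReal.expNeg (c i)) * ρ (A i)) := by
  have hindep := (hP.indep n A hA hρA hdisj).comp (fun i x => ENNReal.expNeg (c i * x))
    fun i => ENNReal.measurable_expNeg.comp (by fun_prop)
  simp_rw [ENNReal.expNeg_sum]
  have := lintegral_prod_eq_prod_lintegral_of_indepFun Finset.univ _ hindep fun i =>
    (ENNReal.measurable_expNeg.comp (by fun_prop)).comp (Measure.measurable_coe (hA i))
  simp only [Function.comp_apply] at this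
  rw [this]
  refine Finset.prod_congr rfl fun i _ => ?_
  rw [hP.lintegral_expNeg_mul_apply (hA i) (hρA i), mul_comm]

theorem lintegral_expNeg_simpleFunc (hP : IsPoissonLaw ρ P) (f : SimpleFunc E ℝ≥0∞)
    (hf : f.FinMeasSupp ρ) :
    ∫⁻ ω, ENNReal.expNeg (∫⁻ x, f x ∂ω) ∂P
      = ENNReal.expNeg (∫⁻ x, (1 - ENNReal.expNeg (f x)) ∂ρ) := by
  classical
  -- The level set of `0` may have infinite `ρ`-measure, where the Poisson law says nothing; it
  -- contributes nothing to either integral.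
  set s := f.range.filter (· ≠ 0)
  have hsum (ν : Measure E) (g : ℝ≥0∞ → ℝ≥0∞) (hg : g 0 = 0) :
      ∫⁻ x, g (f x) ∂ν
        = ∑ i, g (s.equivFin.symm i) * ν (f ⁻¹' {(s.equivFin.symm i : ℝ≥0∞)}) := by
    have h1 := f.map_lintegral (μ := ν) g
    rw [← SimpleFunc.lintegral_eq_lintegral] at h1
    simp only [SimpleFunc.map_apply] at h1
    rw [h1, Equiv.sum_comp s.equivFin.symm fun x : s => g x * ν (f ⁻¹' {(x : ℝ≥0∞)}),
      Finset.sum_coe_sort s fun x => g x * ν (f ⁻¹' {x})]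
    refine (Finset.sum_filter_of_ne fun x _ hx => ?_).symm
    rintro rfl
    simp [hg] at hx
  have hωsum (ω : Measure E) := hsum ω (fun x => x) rfl
  simp_rw [hωsum]
  rw [hsum ρ (fun x => 1 - ENNReal.expNeg x) (by simp)]
  refine hP.lintegral_expNeg_sum (fun i => f ⁻¹' {(s.equivFin.symm i : ℝ≥0∞)})
    (fun i => f.measurableSet_preimage _) (fun i => ?_) (fun i j hij => ?_) _
  · exact hf.meas_preimage_singleton_ne_zero (Finset.mem_filter.1 (s.equivFin.symm i).2).2
  · refine Disjoint.preimage _ (Set.disjoint_singleton.2 fun h => hij ?_)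
    exact s.equivFin.symm.injective (Subtype.ext h)

variable [SigmaFinite ρ]

/-- Campbell's formula: the intensity of a Poisson process is its mean measure. -/
theorem join_eq (hP : IsPoissonLaw ρ P) : Measure.join P = ρ :=
  Measure.ext_of_forall_measure_lt_top ρ fun A hA hρA => by
    rw [Measure.join_apply hA, hP.lintegral_apply hA hρA]

theorem lintegral_lintegral (hP : IsPoissonLaw ρ P) {f : E → ℝ≥0∞} (hf : Measurable f) :
    ∫⁻ ω, ∫⁻ x, f x ∂ω ∂P = ∫⁻ x, f x ∂ρ := by
  rw [← Measure.lintegral_join hf.aemeasurable, hP.join_eq]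

/-- Weighting `P` by `ω B` makes the second moment linear in the remaining factor: the mean measure
of the weighted law is found on sets, then integrated against `f`. The square formula repeats this
with the weight `∫ f dω`. -/
theorem lintegral_lintegral_mul_apply (hP : IsPoissonLaw ρ P) {f : E → ℝ≥0∞} (hf : Measurable f)
    {B : Set E} (hB : MeasurableSet B) (hρB : ρ B < ∞) :
    ∫⁻ ω, (∫⁻ x, f x ∂ω) * ω B ∂P = ∫⁻ x in B, f x ∂ρ + (∫⁻ x, f x ∂ρ) * ρ B := by
  have hjoin : Measure.join (P.withDensity fun ω => ω B) = ρ.restrict B + ρ B • ρ := by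
    refine Measure.ext_of_forall_measure_lt_top ρ fun A hA hρA => ?_
    rw [Measure.join_apply hA, lintegral_withDensity_eq_lintegral_mul _ (Measure.measurable_coe hB)
      (Measure.measurable_coe hA)]
    simp only [Pi.mul_apply, Measure.coe_add, Pi.add_apply, Measure.smul_apply, smul_eq_mul]
    rw [hP.lintegral_apply_mul_apply hB hA hρB hρA, Measure.restrict_apply hA, Set.inter_comm]
  have := Measure.lintegral_join (m := P.withDensity fun ω => ω B) hf.aemeasurable
  rw [hjoin, lintegral_add_measure, lintegral_smul_measure,
    lintegral_withDensity_eq_lintegral_mul _ (Measure.measurable_coe hB)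
      (Measure.measurable_lintegral hf)] at this
  simp only [Pi.mul_apply, smul_eq_mul] at this
  simp_rw [mul_comm _ (Measure.instFunLike.coe _ _)]
  rw [← this]

/-- The second moment formula for integrals with respect to a Poisson process. -/
theorem lintegral_lintegral_sq (hP : IsPoissonLaw ρ P) {f : E → ℝ≥0∞} (hf : Measurable f) :
    ∫⁻ ω, (∫⁻ x, f x ∂ω) ^ 2 ∂P = ∫⁻ x, f x ^ 2 ∂ρ + (∫⁻ x, f x ∂ρ) ^ 2 := by
  have hjoin : Measure.join (P.withDensity fun ω => ∫⁻ x, f x ∂ω)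
      = ρ.withDensity f + (∫⁻ x, f x ∂ρ) • ρ := by
    refine Measure.ext_of_forall_measure_lt_top ρ fun A hA hρA => ?_
    rw [Measure.join_apply hA, lintegral_withDensity_eq_lintegral_mul _
      (Measure.measurable_lintegral hf) (Measure.measurable_coe hA)]
    simp only [Pi.mul_apply, Measure.coe_add, Pi.add_apply, Measure.smul_apply, smul_eq_mul]
    rw [hP.lintegral_lintegral_mul_apply hf hA hρA, withDensity_apply _ hA]
  have := Measure.lintegral_join (m := P.withDensity fun ω => ∫⁻ x, f x ∂ω) hf.aemeasurable
  rw [hjoin, lintegral_add_measure, lintegral_smul_measure,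
    lintegral_withDensity_eq_lintegral_mul _ hf hf,
    lintegral_withDensity_eq_lintegral_mul _ (Measure.measurable_lintegral hf)
      (Measure.measurable_lintegral hf)] at this
  simpa [sq] using this.symm

/-- The Laplace functional of a Poisson process. -/
theorem lintegral_expNeg (hP : IsPoissonLaw ρ P) {g : E → ℝ≥0∞} (hg : Measurable g) :
    ∫⁻ ω, ENNReal.expNeg (∫⁻ x, g x ∂ω) ∂P
      = ENNReal.expNeg (∫⁻ x, (1 - ENNReal.expNeg (g x)) ∂ρ) := by
  have := hP.isProbabilityMeasure
  -- The cut-off to spanning sets gives the approximants supports of finite `ρ`-measure.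
  let f (n : ℕ) : SimpleFunc E ℝ≥0∞ := (SimpleFunc.eapprox g n).restrict (spanningSets ρ n)
  have hfapply (n : ℕ) (x : E) :
      f n x = (spanningSets ρ n).indicator (SimpleFunc.eapprox g n) x :=
    SimpleFunc.restrict_apply _ (measurableSet_spanningSets ρ n) x
  have hfmono : Monotone fun n x => f n x := by
    intro i j hij x
    simp only [hfapply]
    exact (Set.indicator_le_indicator_of_subset (monotone_spanningSets ρ hij)
      (fun _ => zero_le) x).trans
      (Set.indicator_le_indicator (SimpleFunc.monotone_eapprox g hij x))
  have hftendsto (x : E) : Filter.Tendsto (fun n => f n x) Filter.atTop (nhds (g x)) := by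
    have h1 : Filter.Tendsto (fun n => SimpleFunc.eapprox g n x) Filter.atTop (nhds (g x)) := by
      rw [← SimpleFunc.iSup_eapprox_apply hg x]
      exact tendsto_atTop_iSup fun i j hij => SimpleFunc.monotone_eapprox g hij x
    refine h1.congr' ?_
    filter_upwards [eventually_mem_spanningSets ρ x] with n hn
    rw [hfapply, Set.indicator_of_mem hn]
  have hfsupp (n : ℕ) : (f n).FinMeasSupp ρ := by
    refine SimpleFunc.finMeasSupp_iff_support.2
      ((measure_mono ?_).trans_lt (measure_spanningSets_lt_top ρ n))
    intro x hx
    by_contra hxn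
    exact hx ((hfapply n x).trans (Set.indicator_of_notMem hxn _))
  have hint (ν : Measure E) :
      Filter.Tendsto (fun n => ∫⁻ x, f n x ∂ν) Filter.atTop (nhds (∫⁻ x, g x ∂ν)) :=
    lintegral_tendsto_of_tendsto_of_monotone (fun n => (f n).measurable.aemeasurable)
      (ae_of_all _ fun x i j hij => hfmono hij x) (ae_of_all _ hftendsto)
  have hleft : Filter.Tendsto (fun n => ∫⁻ ω, ENNReal.expNeg (∫⁻ x, f n x ∂ω) ∂P) Filter.atTop
      (nhds (∫⁻ ω, ENNReal.expNeg (∫⁻ x, g x ∂ω) ∂P)) :=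
    tendsto_lintegral_of_dominated_convergence (fun _ => 1)
      (fun n => ENNReal.measurable_expNeg.comp (Measure.measurable_lintegral (f n).measurable))
      (fun n => ae_of_all _ fun ω => ENNReal.expNeg_le_one _) (by simp)
      (ae_of_all _ fun ω => (ENNReal.continuous_expNeg.tendsto _).comp (hint ω))
  have hright : Filter.Tendsto (fun n => ∫⁻ x, (1 - ENNReal.expNeg (f n x)) ∂ρ) Filter.atTop
      (nhds (∫⁻ x, (1 - ENNReal.expNeg (g x)) ∂ρ)) :=
    lintegral_tendsto_of_tendsto_of_monotone
      (fun n => (ENNReal.measurable_one_sub_expNeg.comp (f n).measurable).aemeasurable)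
      (ae_of_all _ fun x i j hij => ENNReal.monotone_one_sub_expNeg (hfmono hij x))
      (ae_of_all _ fun x => (ENNReal.continuous_one_sub_expNeg.tendsto _).comp (hftendsto x))
  refine tendsto_nhds_unique hleft (((ENNReal.continuous_expNeg.tendsto _).comp hright).congr ?_)
  exact fun n => (hP.lintegral_expNeg_simpleFunc (f n) (hfsupp n)).symm

end IsPoissonLaw

/-! ### Uniqueness for Laplace functionals and their exponents. -/

namespace MeasureTheory.Measure

/-- A finite measure on `[0, ∞]^I` is determined by its Laplace transform at the points with
integer coordinates. -/
theorem ext_of_lintegral_expNeg_sum {I : Type*} [Fintype I] {m₁ m₂ : Measure (I → ℝ≥0∞)}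
    [IsFiniteMeasure m₁] [IsFiniteMeasure m₂]
    (h : ∀ n : I → ℕ, ∫⁻ x, ENNReal.expNeg (∑ i, x i * n i) ∂m₁
      = ∫⁻ x, ENNReal.expNeg (∑ i, x i * n i) ∂m₂) : m₁ = m₂ := by
  classical
  have hcont (i : I) : Continuous fun x : I → ℝ≥0∞ => (ENNReal.expNeg (x i)).toReal :=
    ENNReal.continuousOn_toReal.comp_continuous
      (ENNReal.continuous_expNeg.comp (continuous_apply i)) fun x => ENNReal.expNeg_ne_top _
  let e (i : I) : BoundedContinuousFunction (I → ℝ≥0∞) ℝ := BoundedContinuousFunction.mkOfCompact ⟨_, hcont i⟩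
  have he (i : I) (x : I → ℝ≥0∞) : e i x = (ENNReal.expNeg (x i)).toReal := rfl
  -- The monomials in the functions `exp(-x i)` are closed under products, so their span is already
  -- an algebra; it separates the points of `[0, ∞]^I`, including those with infinite coordinates.
  let M : Submonoid (BoundedContinuousFunction (I → ℝ≥0∞) ℝ) :=
    { carrier := Set.range fun n : I → ℕ => ∏ i, e i ^ n i
      one_mem' := ⟨0, by simp⟩
      mul_mem' := by
        rintro _ _ ⟨n, rfl⟩ ⟨k, rfl⟩
        exact ⟨n + k, by simp [pow_add, Finset.prod_mul_distrib]⟩ }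
  let A : Subalgebra ℝ (BoundedContinuousFunction (I → ℝ≥0∞) ℝ) := Algebra.adjoin ℝ (M : Set _)
  let B : StarSubalgebra ℝ (BoundedContinuousFunction (I → ℝ≥0∞) ℝ) :=
    { A with
      star_mem' := fun {a} ha => (show star a = a by ext x; simp) ▸ ha }
  have heM (i : I) : e i ∈ M := ⟨Pi.single i 1, by
    simp only [Pi.single_apply]
    rw [Finset.prod_eq_single i (by simp +contextual) (by simp)]
    simp⟩
  refine ext_of_forall_mem_subalgebra_integral_eq_of_polish (𝕜 := ℝ) (A := B) ?_ ?_
  · intro x y hxy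
    obtain ⟨i, hi⟩ := Function.ne_iff.1 hxy
    refine ⟨e i, ⟨BoundedContinuousFunction.toContinuousMapStarₐ ℝ (e i),
      ⟨e i, Algebra.subset_adjoin (heM i), rfl⟩, rfl⟩, ?_⟩
    rw [he, he]
    intro heq
    exact hi (ENNReal.expNeg_injective ((ENNReal.toReal_eq_toReal_iff'
      (ENNReal.expNeg_ne_top _) (ENNReal.expNeg_ne_top _)).1 heq))
  · intro g hg
    have hg' : g ∈ Submodule.span ℝ (M : Set (BoundedContinuousFunction (I → ℝ≥0∞) ℝ)) := by
      have : g ∈ Subalgebra.toSubmodule A := hg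
      rwa [Algebra.adjoin_eq_span, Submonoid.closure_eq] at this
    clear hg
    induction hg' using Submodule.span_induction with
    | mem f hf =>
      obtain ⟨n, rfl⟩ := hf
      have hmon (x : I → ℝ≥0∞) :
          (∏ i, e i ^ n i : BoundedContinuousFunction (I → ℝ≥0∞) ℝ) x
            = (ENNReal.expNeg (∑ i, x i * n i)).toReal := by
        rw [ENNReal.expNeg_sum, ENNReal.toReal_prod, BoundedContinuousFunction.coe_prod,
          Finset.prod_apply]
        refine Finset.prod_congr rfl fun i _ => ?_
        rw [ENNReal.expNeg_mul_natCast, ENNReal.toReal_pow, ← he]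
        rfl
      simp only [hmon]
      have hmeas : Measurable fun x : I → ℝ≥0∞ => ENNReal.expNeg (∑ i, x i * n i) :=
        ENNReal.measurable_expNeg.comp (by fun_prop)
      rw [integral_toReal hmeas.aemeasurable
          (ae_of_all _ fun x => (ENNReal.expNeg_ne_top _).lt_top),
        integral_toReal hmeas.aemeasurable
          (ae_of_all _ fun x => (ENNReal.expNeg_ne_top _).lt_top), h n]
    | zero => simp
    | add f g _ _ hf hg =>
      simp only [BoundedContinuousFunction.coe_add, Pi.add_apply]
      rw [integral_add (f.integrable m₁) (g.integrable m₁),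
        integral_add (f.integrable m₂) (g.integrable m₂), hf, hg]
    | smul c f _ hf =>
      simp only [BoundedContinuousFunction.coe_smul, integral_smul, hf]

/-- A finite measure on the space of measures is determined by its Laplace functional. -/
theorem ext_of_lintegral_expNeg_lintegral {X : Type*} [MeasurableSpace X]
    {m₁ m₂ : Measure (Measure X)} [IsFiniteMeasure m₁] [IsFiniteMeasure m₂]
    (h : ∀ f : X → ℝ≥0∞, Measurable f → ∫⁻ ξ, ENNReal.expNeg (∫⁻ x, f x ∂ξ) ∂m₁
      = ∫⁻ ξ, ENNReal.expNeg (∫⁻ x, f x ∂ξ) ∂m₂) : m₁ = m₂ := by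
  let Φ (ξ : Measure X) (A : {A : Set X // MeasurableSet A}) : ℝ≥0∞ := ξ A
  have hΦ : Measurable Φ := measurable_pi_lambda _ fun A => measurable_coe A.2
  -- The evaluations generate the σ-algebra on measures, so the finite-dimensional marginals of `ξ ↦
  -- (ξ A)_A` determine the law.
  have hcomap : (instMeasurableSpace : MeasurableSpace (Measure X))
      ≤ MeasurableSpace.comap Φ MeasurableSpace.pi := by
    refine iSup₂_le fun A hA => ?_
    have : Measurable[MeasurableSpace.comap Φ MeasurableSpace.pi] fun ξ : Measure X => ξ A :=
      (measurable_pi_apply (⟨A, hA⟩ : {A : Set X // MeasurableSet A})).comp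
        (comap_measurable Φ)
    exact (ENNReal.borelSpace.measurable_eq ▸ this).comap_le
  have hmap : m₁.map Φ = m₂.map Φ := by
    refine IsProjectiveLimit.unique (P := fun J => (m₂.map Φ).map J.restrict) (fun J => ?_)
      fun J => rfl
    refine ext_of_lintegral_expNeg_sum fun n => ?_
    have hΨ : Measurable fun x : J → ℝ≥0∞ => ENNReal.expNeg (∑ i, x i * n i) :=
      ENNReal.measurable_expNeg.comp (by fun_prop)
    have hJ : Measurable (J.restrict (π := fun _ => ℝ≥0∞)) := Finset.measurable_restrict J
    have hΨJ : Measurable fun x : {A : Set X // MeasurableSet A} → ℝ≥0∞ =>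
        ENNReal.expNeg (∑ i, J.restrict x i * n i) := hΨ.comp hJ
    rw [lintegral_map hΨ hJ, lintegral_map hΨ hJ, lintegral_map hΨJ hΦ, lintegral_map hΨJ hΦ]
    have hf : Measurable fun x => ∑ i : J, (i.1.1).indicator (fun _ => (n i : ℝ≥0∞)) x :=
      Finset.measurable_fun_sum _ fun i _ => measurable_const.indicator i.1.2
    have := h _ hf
    have hint (ξ : Measure X) :
        ∫⁻ x, ∑ i : J, (i.1.1).indicator (fun _ => (n i : ℝ≥0∞)) x ∂ξ
          = ∑ i : J, J.restrict (Φ ξ) i * n i := by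
      rw [lintegral_finsetSum _ fun i _ => measurable_const.indicator i.1.2]
      refine Finset.sum_congr rfl fun i _ => ?_
      rw [lintegral_indicator_const i.1.2, mul_comm]
      rfl
    simpa only [hint] using this
  ext S hS
  obtain ⟨S', hS', rfl⟩ := hcomap S hS
  rw [← map_apply hΦ hS', hmap, map_apply hΦ hS']

end MeasureTheory.Measure

namespace MeasureTheory.Measure

/-- A measure on the space of nonzero measures, with an intensity which is `σ`-finite in the sense
that some strictly positive function is integrable, is determined by the exponent
`f ↦ ∫ (1 - exp (-∫ f dξ)) ρ(dξ)` of the Laplace functional of the Poisson integral. -/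
theorem ext_of_lintegral_one_sub_expNeg {X : Type*} [MeasurableSpace X]
    {ρ₁ ρ₂ : Measure (Measure X)} (h₁ : ∀ᵐ ξ ∂ρ₁, ξ ≠ 0) (h₂ : ∀ᵐ ξ ∂ρ₂, ξ ≠ 0)
    {w : X → ℝ≥0∞} (hw : Measurable w) (hw_pos : ∀ x, w x ≠ 0)
    (hw_int : ∫⁻ ξ, ∫⁻ x, w x ∂ξ ∂ρ₁ ≠ ∞)
    (h : ∀ f : X → ℝ≥0∞, Measurable f → ∫⁻ ξ, (1 - ENNReal.expNeg (∫⁻ x, f x ∂ξ)) ∂ρ₁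
      = ∫⁻ ξ, (1 - ENNReal.expNeg (∫⁻ x, f x ∂ξ)) ∂ρ₂) : ρ₁ = ρ₂ := by
  have hlin {f : X → ℝ≥0∞} (hf : Measurable f) :
      Measurable fun ξ : Measure X => ∫⁻ x, f x ∂ξ := measurable_lintegral hf
  have hexp {f : X → ℝ≥0∞} (hf : Measurable f) :
      Measurable fun ξ : Measure X => ENNReal.expNeg (∫⁻ x, f x ∂ξ) :=
    ENNReal.measurable_expNeg.comp (hlin hf)
  have hone {f : X → ℝ≥0∞} (hf : Measurable f) :
      Measurable fun ξ : Measure X => 1 - ENNReal.expNeg (∫⁻ x, f x ∂ξ) :=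
    ENNReal.measurable_one_sub_expNeg.comp (hlin hf)
  -- The density `d` makes both measures finite and vanishes only at `ξ = 0`, so it can be divided
  -- out at the end. The Laplace functional of the weighted measure at `f` is the exponent at `f +
  -- w` minus the exponent at `f`.
  set d : Measure X → ℝ≥0∞ := fun ξ => 1 - ENNReal.expNeg (∫⁻ x, w x ∂ξ) with hd
  have hd_meas : Measurable d := hone hw
  have hd_top (ξ : Measure X) : d ξ ≠ ∞ := ne_top_of_le_ne_top ENNReal.one_ne_top tsub_le_self
  have hd_zero {ξ : Measure X} (hξ : ξ ≠ 0) : d ξ ≠ 0 := by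
    rw [hd, Ne, ENNReal.one_sub_expNeg_eq_zero, lintegral_eq_zero_iff hw]
    intro hzero
    refine hξ (ae_eq_bot.1 (Filter.eventually_false_iff_eq_bot.1 ?_))
    filter_upwards [hzero] with x hx using hw_pos x hx
  have hfin₁ : ∫⁻ ξ, d ξ ∂ρ₁ ≠ ∞ :=
    ne_top_of_le_ne_top hw_int (lintegral_mono fun ξ => ENNReal.one_sub_expNeg_le _)
  have hfin₂ : ∫⁻ ξ, d ξ ∂ρ₂ ≠ ∞ := h w hw ▸ hfin₁
  have : IsFiniteMeasure (ρ₁.withDensity d) := isFiniteMeasure_withDensity hfin₁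
  have : IsFiniteMeasure (ρ₂.withDensity d) := isFiniteMeasure_withDensity hfin₂
  -- The bound `f ≤ k * w` makes the exponent at `f` finite, so that it can be cancelled.
  have hfinite (f : X → ℝ≥0∞) (hf : Measurable f) (k : ℕ) (hfk : ∀ x, f x ≤ k * w x) :
      ∫⁻ ξ, ENNReal.expNeg (∫⁻ x, f x ∂ξ) ∂ρ₁.withDensity d
        = ∫⁻ ξ, ENNReal.expNeg (∫⁻ x, f x ∂ξ) ∂ρ₂.withDensity d := by
    have hΛ : ∫⁻ ξ, (1 - ENNReal.expNeg (∫⁻ x, f x ∂ξ)) ∂ρ₁ ≠ ∞ := by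
      refine ne_top_of_le_ne_top (ENNReal.mul_ne_top (ENNReal.natCast_ne_top k) hw_int) ?_
      rw [← lintegral_const_mul _ (hlin hw)]
      refine lintegral_mono fun ξ => (ENNReal.one_sub_expNeg_le _).trans ?_
      rw [← lintegral_const_mul _ hw]
      exact lintegral_mono hfk
    have hsplit (ρ : Measure (Measure X)) :
        ∫⁻ ξ, (1 - ENNReal.expNeg (∫⁻ x, (f x + w x) ∂ξ)) ∂ρ
          = ∫⁻ ξ, (1 - ENNReal.expNeg (∫⁻ x, f x ∂ξ)) ∂ρ
            + ∫⁻ ξ, ENNReal.expNeg (∫⁻ x, f x ∂ξ) ∂ρ.withDensity d := by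
      rw [lintegral_withDensity_eq_lintegral_mul _ hd_meas (hexp hf),
        ← lintegral_add_left (hone hf)]
      refine lintegral_congr fun ξ => ?_
      rw [lintegral_add_left hf, ENNReal.one_sub_expNeg_add, Pi.mul_apply, mul_comm (d ξ)]
    have hsum := h _ (hf.add hw)
    simp only [Pi.add_apply] at hsum
    rw [hsplit, hsplit, ← h f hf] at hsum
    exact (ENNReal.add_right_inj hΛ).1 hsum
  have hdens : ρ₁.withDensity d = ρ₂.withDensity d := by
    refine ext_of_lintegral_expNeg_lintegral fun f hf => ?_
    -- Since `w` never vanishes, these truncations increase to `f`, even where `f = ∞`.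
    let g (k : ℕ) (x : X) : ℝ≥0∞ := min (f x) (k * w x)
    have hg (k : ℕ) : Measurable (g k) := hf.min (hw.const_mul _)
    have hg_mono : Monotone g := fun i j hij x => min_le_min_left _ (by gcongr)
    have hg_tendsto (x : X) : Filter.Tendsto (fun k => g k x) Filter.atTop (nhds (f x)) := by
      have h1 : Filter.Tendsto (fun k : ℕ => (k : ℝ≥0∞) * w x) Filter.atTop (nhds ∞) := by
        have := ENNReal.Tendsto.mul_const (b := w x) ENNReal.tendsto_nat_nhds_top
          (Or.inl ENNReal.top_ne_zero)
        rwa [ENNReal.top_mul (hw_pos x)] at this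
      simpa using (tendsto_const_nhds (x := f x)).min h1
    have hlim (m : Measure (Measure X)) [IsFiniteMeasure m] :
        Filter.Tendsto (fun k => ∫⁻ ξ, ENNReal.expNeg (∫⁻ x, g k x ∂ξ) ∂m) Filter.atTop
          (nhds (∫⁻ ξ, ENNReal.expNeg (∫⁻ x, f x ∂ξ) ∂m)) :=
      tendsto_lintegral_of_dominated_convergence (fun _ => 1) (fun k => hexp (hg k))
        (fun k => ae_of_all _ fun ξ => ENNReal.expNeg_le_one _) (by simp)
        (ae_of_all _ fun ξ => (ENNReal.continuous_expNeg.tendsto _).comp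
          (lintegral_tendsto_of_tendsto_of_monotone (fun k => (hg k).aemeasurable)
            (ae_of_all _ fun x i j hij => hg_mono hij x) (ae_of_all _ hg_tendsto)))
    exact tendsto_nhds_unique (hlim _)
      ((hlim _).congr fun k => (hfinite _ (hg k) k fun x => min_le_right _ _).symm)
  rw [← withDensity_inv_same hd_meas (h₁.mono fun ξ => hd_zero) (ae_of_all _ hd_top), hdens,
    withDensity_inv_same hd_meas (h₂.mono fun ξ => hd_zero) (ae_of_all _ hd_top)]

end MeasureTheory.Measure

/-! ### The transformation `T_*`. -/

theorem measurable_pushMeasure {X : Type*} [MeasurableSpace X] (T : X ≃ᵐ X) :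
    Measurable (pushMeasure T) := Measure.measurable_map T T.measurable

theorem lintegral_pushMeasure {X : Type*} [MeasurableSpace X] (T : X ≃ᵐ X) (ξ : Measure X)
    (f : X → ℝ≥0∞) : ∫⁻ x, f x ∂pushMeasure T ξ = ∫⁻ x, f (T x) ∂ξ :=
  lintegral_map_equiv f T

theorem pushMeasure_ne_zero {X : Type*} [MeasurableSpace X] (T : X ≃ᵐ X) {ξ : Measure X}
    (hξ : ξ ≠ 0) : pushMeasure T ξ ≠ 0 := by
  rwa [pushMeasure, Ne, Measure.map_eq_zero_iff T.measurable.aemeasurable]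

/-! ### Measurability of the set of discrete measures. -/

section Discrete

variable {X : Type*} [MetricSpace X] [TopologicalSpace.SeparableSpace X] [MeasurableSpace X]
  [BorelSpace X]

theorem DiscreteMeasure.mono {Y : Type*} [MeasurableSpace Y] {ξ η : Measure Y}
    (hη : DiscreteMeasure η) (h : ξ ≤ η) : DiscreteMeasure ξ := by
  obtain ⟨S, hS, hS0⟩ := hη
  exact ⟨S, hS, le_antisymm ((h _).trans hS0.le) zero_le⟩

/-- The kernel `ξ ↦ ξ (· | B)`, which vanishes at the `ξ` that give `B` measure `0` or `∞`. -/
noncomputable def normalizedRestriction {Y : Type*} [MeasurableSpace Y] (B : Set Y)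
    (hB : MeasurableSet B) : Kernel (Measure Y) Y where
  toFun ξ := (ξ B)⁻¹ • ξ.restrict B
  measurable' := by
    refine Measure.measurable_of_measurable_coe _ fun s hs => ?_
    simp only [Measure.smul_apply, smul_eq_mul, Measure.restrict_apply hs]
    exact (Measure.measurable_coe hB).inv.mul (Measure.measurable_coe (hs.inter hB))

/-- The normalisation bounds the mass uniformly in `ξ`, as the measurability of kernel sections
requires; where `ξ B < ∞` it keeps the null sets of `ξ.restrict B`. -/
instance {Y : Type*} [MeasurableSpace Y] (B : Set Y) (hB : MeasurableSet B) :
    IsFiniteKernel (normalizedRestriction B hB) :=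
  ⟨⟨1, ENNReal.one_lt_top, fun ξ => by
    simp [normalizedRestriction, ENNReal.inv_mul_le_one]⟩⟩

/-- The diagonal is measurable, so `(ξ, x) ↦ κ ξ {x}` is jointly measurable, and so is the mass of
the set of non-atoms. -/
theorem measurableSet_atomless_part_null (κ : Kernel (Measure X) X) [IsFiniteKernel κ] :
    MeasurableSet {ξ : Measure X | κ ξ {x | κ ξ {x} = 0} = 0} := by
  have := UniformSpace.secondCountable_of_separable X
  have hatom : Measurable fun p : Measure X × X => κ p.1 {p.2} := by
    have hdiag : MeasurableSet {q : (Measure X × X) × X | q.2 = q.1.2} :=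
      measurableSet_eq_fun measurable_snd (measurable_snd.comp measurable_fst)
    exact (Kernel.prodMkRight X κ).measurable_kernel_prodMk_left hdiag
  have hzero : MeasurableSet {p : Measure X × X | κ p.1 {p.2} = 0} :=
    hatom (measurableSet_singleton 0)
  exact κ.measurable_kernel_prodMk_left hzero (measurableSet_singleton 0)

theorem countable_setOf_measure_singleton_ne_zero (ν : Measure X) [IsFiniteMeasure ν] :
    {x | ν {x} ≠ 0}.Countable := by
  have := Measure.countable_meas_pos_of_disjoint_iUnion (μ := ν) (As := fun x : X => {x})
    (fun x => measurableSet_singleton x) (fun x y hxy => Set.disjoint_singleton.2 hxy)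
  simpa [pos_iff_ne_zero] using this

/-- This replaces the quantifier over countable sets by countably many measurable conditions. The
carrier is the union of the atoms in the balls, countable because each restriction is finite. -/
theorem BoundedlyFinite.discreteMeasure_iff {ξ : Measure X} (hξ : BoundedlyFinite ξ) (a : X) :
    DiscreteMeasure ξ ↔ ∀ n : ℕ,
      normalizedRestriction (Metric.ball a n) Metric.isOpen_ball.measurableSet ξ
        {x | normalizedRestriction (Metric.ball a n) Metric.isOpen_ball.measurableSet ξ {x} = 0}
        = 0 := by
  set κ := fun n : ℕ => normalizedRestriction (Metric.ball a n) Metric.isOpen_ball.measurableSet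
    with hκ
  have happly (n : ℕ) (S : Set X) :
      κ n ξ S = (ξ (Metric.ball a n))⁻¹ * ξ (S ∩ Metric.ball a n) := by
    rw [← Measure.restrict_apply' Metric.isOpen_ball.measurableSet]
    rfl
  constructor
  · rintro ⟨S, hS, hS0⟩ n
    have hκS : κ n ξ Sᶜ = 0 := by
      rw [happly, measure_mono_null Set.inter_subset_left hS0, mul_zero]
    refine measure_mono_null (t := Sᶜ ∪ (S ∩ {x | κ n ξ {x} = 0}))
      (fun x hx => ?_) (measure_union_null hκS ?_)
    · by_cases hxS : x ∈ S
      · exact Or.inr ⟨hxS, hx⟩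
      · exact Or.inl hxS
    · exact (measure_null_iff_singleton (hS.mono Set.inter_subset_left)).2 fun x hx => hx.2
  · intro h
    refine ⟨⋃ n, {x | κ n ξ {x} ≠ 0},
      Set.countable_iUnion fun n => countable_setOf_measure_singleton_ne_zero _, ?_⟩
    rw [← Set.inter_univ (⋃ n, {x | κ n ξ {x} ≠ 0})ᶜ, ← Metric.iUnion_ball_nat a,
      Set.inter_iUnion, measure_iUnion_null_iff]
    intro n
    have hn : κ n ξ (⋃ n, {x | κ n ξ {x} ≠ 0})ᶜ = 0 := by
      refine measure_mono_null (fun x hx => ?_) (h n)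
      simp only [Set.compl_iUnion, Set.mem_iInter] at hx
      exact not_not.1 (hx n)
    rw [happly] at hn
    exact (mul_eq_zero.1 hn).resolve_left (ENNReal.inv_ne_zero.2
      (hξ _ Metric.isOpen_ball.measurableSet Metric.isBounded_ball).ne)

theorem measurableSet_boundedlyFinite_discreteMeasure :
    MeasurableSet {ξ : Measure X | BoundedlyFinite ξ ∧ DiscreteMeasure ξ} := by
  rcases isEmpty_or_nonempty X with hX | ⟨⟨a⟩⟩
  · have : Subsingleton (Measure X) := inferInstance
    exact Subsingleton.measurableSet
  · have : {ξ : Measure X | BoundedlyFinite ξ ∧ DiscreteMeasure ξ} = {ξ | BoundedlyFinite ξ} ∩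
        ⋂ n : ℕ, {ξ | normalizedRestriction (Metric.ball a n) Metric.isOpen_ball.measurableSet ξ
          {x | normalizedRestriction (Metric.ball a n) Metric.isOpen_ball.measurableSet ξ {x} = 0}
          = 0} := by
      ext ξ
      simp only [Set.mem_inter_iff, Set.mem_iInter, Set.mem_ofPred_eq]
      exact and_congr_right fun hξ => hξ.discreteMeasure_iff a
    rw [this]
    exact measurableSet_boundedlyFinite.inter
      (MeasurableSet.iInter fun n => measurableSet_atomless_part_null _)

end Discrete

theorem BoundedlyFinite.sigmaFinite {X : Type*} [MetricSpace X]
    [TopologicalSpace.SeparableSpace X] [MeasurableSpace X] [BorelSpace X] {μ : Measure X}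
    (hμ : BoundedlyFinite μ) : SigmaFinite μ := by
  have := UniformSpace.secondCountable_of_separable X
  have : IsLocallyFiniteMeasure μ := ⟨fun x => ⟨Metric.ball x 1, Metric.ball_mem_nhds x one_pos,
    hμ _ Metric.isOpen_ball.measurableSet Metric.isBounded_ball⟩⟩
  infer_instance

/-- Each Dirac mass of `ω` sits at a measure that is one summand of `join ω`. -/
theorem CountingMeasure.ae_le_join {X : Type*} [MeasurableSpace X] {ω : Measure (Measure X)}
    (hω : CountingMeasure ω) {p : Measure X → Prop} (hp : MeasurableSet {ξ | p ξ})
    (h : ∀ ξ ≤ Measure.join ω, p ξ) : ∀ᵐ ξ ∂ω, p ξ := by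
  obtain ⟨I, x, rfl⟩ := hω
  refine (Measure.ae_sum_iff' hp).2 fun i => (ae_dirac_iff hp).2 (h _ ?_)
  rw [Measure.join_sum]
  simp only [Measure.join_dirac]
  exact Measure.le_sum x i

/-! ### The Poisson integral `Measure.join ω`: drift, moments, invariance, ergodicity. -/

section

variable {X : Type*} [MeasurableSpace X] {m ρ : Measure (Measure X)}
  {P : Measure (Measure (Measure X))} {γ : Measure X}

/-- A random measure with atomless intensity and almost surely discrete values has no drift. -/
theorem IsPoissonLaw.drift_eq_zero (hP : IsPoissonLaw ρ P) {μ : Measure X}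
    [NullSingletonClass μ] (hm : m = P.map fun ω => γ + Measure.join ω)
    (hm_int : ∀ A : Set X, MeasurableSet A → ∫⁻ ξ, ξ A ∂m = μ A)
    (hm_disc : ∀ᵐ ξ ∂m, DiscreteMeasure ξ) : γ = 0 := by
  have := hP.isProbabilityMeasure
  have hmeas : Measurable fun ω : Measure (Measure X) => γ + Measure.join ω :=
    measurable_const.add Measure.measurable_join
  have hle : γ ≤ μ := by
    refine Measure.le_iff.2 fun A hA => ?_
    rw [← hm_int A hA, hm, lintegral_map (Measure.measurable_coe hA) hmeas]
    calc γ A = ∫⁻ _, γ A ∂P := by simp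
      _ ≤ ∫⁻ ω, (γ + Measure.join ω) A ∂P :=
        lintegral_mono fun ω => Measure.le_add_right le_rfl A
  rw [hm] at hm_disc
  -- As `γ` is deterministic, one realisation suffices.
  obtain ⟨ω, hω⟩ := (ae_of_ae_map hmeas.aemeasurable hm_disc).exists
  obtain ⟨S, hS, hS0⟩ := hω.mono (Measure.le_add_right le_rfl : γ ≤ γ + Measure.join ω)
  have hγS : γ S = 0 := le_antisymm ((hle S).trans (hS.measure_zero μ).le) zero_le
  rw [← Measure.measure_univ_eq_zero, ← Set.union_compl_self S]
  exact measure_union_null hγS hS0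

theorem lintegral_map_join {f : X → ℝ≥0∞} (hf : Measurable f) {φ : ℝ≥0∞ → ℝ≥0∞}
    (hφ : Measurable φ) : ∫⁻ ξ, φ (∫⁻ x, f x ∂ξ) ∂P.map Measure.join
      = ∫⁻ ω, φ (∫⁻ ξ, ∫⁻ x, f x ∂ξ ∂ω) ∂P := by
  have hφf : Measurable fun ξ : Measure X => φ (∫⁻ x, f x ∂ξ) :=
    hφ.comp (Measure.measurable_lintegral hf)
  rw [lintegral_map hφf Measure.measurable_join]
  simp_rw [Measure.lintegral_join hf.aemeasurable]

variable [SigmaFinite ρ]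

theorem IsPoissonLaw.lintegral_apply_map_join (hP : IsPoissonLaw ρ P) {A : Set X}
    (hA : MeasurableSet A) : ∫⁻ ξ, ξ A ∂P.map Measure.join = ∫⁻ ξ, ξ A ∂ρ := by
  rw [lintegral_map (Measure.measurable_coe hA) Measure.measurable_join]
  simp_rw [Measure.join_apply hA]
  exact hP.lintegral_lintegral (Measure.measurable_coe hA)

theorem IsPoissonLaw.lintegral_apply_sq_map_join (hP : IsPoissonLaw ρ P) {A : Set X}
    (hA : MeasurableSet A) :
    ∫⁻ ξ, ξ A ^ 2 ∂P.map Measure.join = ∫⁻ ξ, ξ A ^ 2 ∂ρ + (∫⁻ ξ, ξ A ∂ρ) ^ 2 := by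
  rw [lintegral_map ((Measure.measurable_coe hA).pow_const 2) Measure.measurable_join]
  simp_rw [Measure.join_apply hA]
  exact hP.lintegral_lintegral_sq (Measure.measurable_coe hA)

theorem IsPoissonLaw.lintegral_expNeg_map_join (hP : IsPoissonLaw ρ P) {f : X → ℝ≥0∞}
    (hf : Measurable f) : ∫⁻ ξ, ENNReal.expNeg (∫⁻ x, f x ∂ξ) ∂P.map Measure.join
      = ENNReal.expNeg (∫⁻ ξ, (1 - ENNReal.expNeg (∫⁻ x, f x ∂ξ)) ∂ρ) := by
  rw [lintegral_map_join hf ENNReal.measurable_expNeg,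
    hP.lintegral_expNeg (Measure.measurable_lintegral hf)]

/-- The Laplace functional of the Poisson integral on the event that no point lies in `K`. -/
theorem IsPoissonLaw.lintegral_expNeg_map_join_restrict (hP : IsPoissonLaw ρ P)
    {K : Set (Measure X)} (hK : MeasurableSet K) {f : X → ℝ≥0∞} (hf : Measurable f) :
    ∫⁻ ξ, ENNReal.expNeg (∫⁻ x, f x ∂ξ) ∂(P.restrict {ω | ω K = 0}).map Measure.join
      = ENNReal.expNeg (ρ K + ∫⁻ ξ in Kᶜ, (1 - ENNReal.expNeg (∫⁻ x, f x ∂ξ)) ∂ρ) := by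
  have hvoid : MeasurableSet {ω : Measure (Measure X) | ω K = 0} :=
    Measure.measurable_coe hK (measurableSet_singleton 0)
  have hlin := Measure.measurable_lintegral hf
  have hKtop : Measurable (K.indicator fun _ => (∞ : ℝ≥0∞)) := measurable_const.indicator hK
  -- `exp(-∞ * ω K)` is the indicator of `ω K = 0`, so restricting to this event amounts to adding
  -- `∞` on `K` to the test function.
  have key := hP.lintegral_expNeg (hlin.add hKtop)
  rw [lintegral_map_join hf ENNReal.measurable_expNeg, ← lintegral_indicator hvoid]
  convert key using 1
  · refine lintegral_congr fun ω => ?_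
    simp only [Pi.add_apply]
    rw [lintegral_add_left hlin, lintegral_indicator_const hK]
    by_cases hω : ω K = 0
    · rw [Set.indicator_of_mem (show ω ∈ {ω | ω K = 0} from hω), hω, mul_zero, add_zero]
    · rw [Set.indicator_of_notMem (show ω ∉ {ω | ω K = 0} from hω), ENNReal.top_mul hω,
        add_top, ENNReal.expNeg_top]
  · rw [← lintegral_add_compl (fun ξ : Measure X => 1 - ENNReal.expNeg
      (((fun ξ => ∫⁻ x, f x ∂ξ) + K.indicator fun _ => ∞) ξ)) hK]
    congr 2
    · rw [← setLIntegral_one]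
      refine setLIntegral_congr_fun hK fun ξ hξ => ?_
      simp [Set.indicator_of_mem hξ]
    · refine setLIntegral_congr_fun hK.compl fun ξ hξ => ?_
      simp [Set.indicator_of_notMem hξ]

/-- The intensity of an invariant Poisson integral is invariant. -/
theorem IsPoissonLaw.measurePreserving_pushMeasure (hP : IsPoissonLaw ρ P) (T : X ≃ᵐ X)
    (hT : MeasurePreserving (pushMeasure T) (P.map Measure.join) (P.map Measure.join))
    (hρ : ∀ᵐ ξ ∂ρ, ξ ≠ 0) {w : X → ℝ≥0∞} (hw : Measurable w) (hw_pos : ∀ x, w x ≠ 0)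
    (hw_int : ∫⁻ ξ, ∫⁻ x, w x ∂ξ ∂ρ ≠ ∞) : MeasurePreserving (pushMeasure T) ρ ρ := by
  have hTm := measurable_pushMeasure T
  refine ⟨hTm, (Measure.ext_of_lintegral_one_sub_expNeg hρ ?_ hw hw_pos hw_int
    fun f hf => ?_).symm⟩
  · have hne : MeasurableSet {ξ : Measure X | ξ ≠ 0} := by
      have : {ξ : Measure X | ξ ≠ 0} = (fun ξ : Measure X => ξ Set.univ) ⁻¹' {0}ᶜ := by
        ext ξ; simp
      rw [this]
      exact Measure.measurable_coe MeasurableSet.univ (measurableSet_singleton 0).compl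
    exact (ae_map_iff hTm.aemeasurable hne).2 (hρ.mono fun ξ => pushMeasure_ne_zero T)
  · have hexp : Measurable fun ξ : Measure X => ENNReal.expNeg (∫⁻ x, f x ∂ξ) :=
      ENNReal.measurable_expNeg.comp (Measure.measurable_lintegral hf)
    have hone : Measurable fun ξ : Measure X => 1 - ENNReal.expNeg (∫⁻ x, f x ∂ξ) :=
      ENNReal.measurable_one_sub_expNeg.comp (Measure.measurable_lintegral hf)
    apply ENNReal.expNeg_injective
    rw [← hP.lintegral_expNeg_map_join hf, ← hT.lintegral_comp hexp, lintegral_map hone hTm]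
    simp_rw [lintegral_pushMeasure]
    exact hP.lintegral_expNeg_map_join (hf.comp T.measurable)

/-- If the Poisson integral is ergodic, then its intensity has no invariant set of finite nonzero
measure. -/
theorem IsPoissonLaw.measure_eq_zero_of_invariant (hP : IsPoissonLaw ρ P) (T : X ≃ᵐ X)
    (hT : Ergodic (pushMeasure T) (P.map Measure.join))
    (hTρ : MeasurePreserving (pushMeasure T) ρ ρ)
    (hρ : ∀ᵐ ξ ∂ρ, ξ ≠ 0) {w : X → ℝ≥0∞} (hw : Measurable w) (hw_pos : ∀ x, w x ≠ 0)
    (hw_int : ∫⁻ ξ, ∫⁻ x, w x ∂ξ ∂ρ ≠ ∞) {K : Set (Measure X)} (hK : MeasurableSet K)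
    (hKT : pushMeasure T ⁻¹' K =ᵐ[ρ] K) (hρK : ρ K < ∞) : ρ K = 0 := by
  have := hP.isProbabilityMeasure
  have := Measure.isProbabilityMeasure_map (μ := P) Measure.measurable_join.aemeasurable
  have hTm := measurable_pushMeasure T
  set m' := (P.restrict {ω | ω K = 0}).map Measure.join with hm'
  have hexp {f : X → ℝ≥0∞} (hf : Measurable f) :
      Measurable fun ξ : Measure X => ENNReal.expNeg (∫⁻ x, f x ∂ξ) :=
    ENNReal.measurable_expNeg.comp (Measure.measurable_lintegral hf)
  have hone {f : X → ℝ≥0∞} (hf : Measurable f) :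
      Measurable fun ξ : Measure X => 1 - ENNReal.expNeg (∫⁻ x, f x ∂ξ) :=
    ENNReal.measurable_one_sub_expNeg.comp (Measure.measurable_lintegral hf)
  -- By the void formula the Laplace functional of `m'` involves only `ρ K` and `ρ` on `Kᶜ`, and
  -- both `ρ` and `K` are invariant.
  have hinv : MeasurePreserving (pushMeasure T) m' m' := by
    refine ⟨hTm, Measure.ext_of_lintegral_expNeg_lintegral fun f hf => ?_⟩
    rw [lintegral_map (hexp hf) hTm]
    simp_rw [lintegral_pushMeasure]
    have hfT : Measurable fun x => f (T x) := hf.comp T.measurable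
    rw [hP.lintegral_expNeg_map_join_restrict hK hf,
      hP.lintegral_expNeg_map_join_restrict hK hfT, ← hTρ.setLIntegral_comp_preimage hK.compl
        (hone hf)]
    simp_rw [lintegral_pushMeasure]
    congr 2
    exact setLIntegral_congr hKT.symm.compl
  obtain ⟨c, hc⟩ := hT.eq_smul_of_absolutelyContinuous hinv
    (Measure.restrict_le_self.absolutelyContinuous.map Measure.measurable_join)
  have hLap {f : X → ℝ≥0∞} (hf : Measurable f) :
      ENNReal.expNeg (ρ K + ∫⁻ ξ in Kᶜ, (1 - ENNReal.expNeg (∫⁻ x, f x ∂ξ)) ∂ρ)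
        = c * ENNReal.expNeg (∫⁻ ξ, (1 - ENNReal.expNeg (∫⁻ x, f x ∂ξ)) ∂ρ) := by
    rw [← hP.lintegral_expNeg_map_join_restrict hK hf, ← hP.lintegral_expNeg_map_join hf, ← hm',
      hc, lintegral_smul_measure, smul_eq_mul]
  -- The test function `0` gives the total mass.
  have hc0 : c = ENNReal.expNeg (ρ K) := by
    simpa using (hLap (measurable_const (a := (0 : ℝ≥0∞)))).symm
  have hfin : ∫⁻ ξ, (1 - ENNReal.expNeg (∫⁻ x, w x ∂ξ)) ∂ρ ≠ ∞ :=
    ne_top_of_le_ne_top hw_int (lintegral_mono fun ξ => ENNReal.one_sub_expNeg_le _)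
  have heq := hLap hw
  rw [hc0, ← ENNReal.expNeg_add] at heq
  -- Here `ρ K < ∞` is essential: the common term `ρ K` cancels in the exponents.
  have heq' := (ENNReal.add_right_inj hρK.ne).1 (ENNReal.expNeg_injective heq)
  have hadd := lintegral_add_compl (μ := ρ)
    (fun ξ : Measure X => 1 - ENNReal.expNeg (∫⁻ x, w x ∂ξ)) hK
  rw [← hadd] at hfin
  have hzero : ∫⁻ ξ in K, (1 - ENNReal.expNeg (∫⁻ x, w x ∂ξ)) ∂ρ = 0 := by
    refine (ENNReal.add_left_inj (ENNReal.add_ne_top.1 hfin).2).1 ?_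
    rw [zero_add]
    exact hadd.trans heq'.symm
  rw [setLIntegral_eq_zero_iff hK (hone hw)] at hzero
  rw [measure_eq_zero_iff_ae_notMem]
  filter_upwards [hzero, hρ] with ξ hξ hξ0 hξK
  have hξw := ENNReal.one_sub_expNeg_eq_zero.1 (hξ hξK)
  rw [lintegral_eq_zero_iff hw] at hξw
  refine hξ0 (ae_eq_bot.1 (Filter.eventually_false_iff_eq_bot.1 ?_))
  filter_upwards [hξw] with x hx using hw_pos x hx

end

/-! ### Discreteness of the Lévy measure, variance, and conclusion. -/

theorem IsPoissonLaw.ae_boundedlyFinite_discreteMeasure {X : Type*} [MetricSpace X]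
    [TopologicalSpace.SeparableSpace X] [MeasurableSpace X] [BorelSpace X]
    {ρ : Measure (Measure X)} {P : Measure (Measure (Measure X))} [SigmaFinite ρ]
    (hP : IsPoissonLaw ρ P) (hbf : ∀ᵐ ξ ∂ρ, BoundedlyFinite ξ)
    (hdisc : ∀ᵐ ω ∂P, DiscreteMeasure (Measure.join ω)) :
    ∀ᵐ ξ ∂ρ, BoundedlyFinite ξ ∧ DiscreteMeasure ξ := by
  have hmeas : MeasurableSet {ξ : Measure X | BoundedlyFinite ξ → DiscreteMeasure ξ} := by
    have : {ξ : Measure X | BoundedlyFinite ξ → DiscreteMeasure ξ}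
        = {ξ | BoundedlyFinite ξ}ᶜ ∪ {ξ | BoundedlyFinite ξ ∧ DiscreteMeasure ξ} := by
      ext ξ
      by_cases h : BoundedlyFinite ξ <;> simp [h]
    rw [this]
    exact measurableSet_boundedlyFinite.compl.union measurableSet_boundedlyFinite_discreteMeasure
  have himp : ∀ᵐ ξ ∂ρ, BoundedlyFinite ξ → DiscreteMeasure ξ := by
    -- By `ρ = join P`, a measurable set is `ρ`-null as soon as it is `ω`-null for `P`-almost every
    -- `ω`.
    rw [← hP.join_eq, ae_iff]
    change Measure.join P {ξ | BoundedlyFinite ξ → DiscreteMeasure ξ}ᶜ = 0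
    rw [Measure.join_apply hmeas.compl,
      lintegral_eq_zero_iff (Measure.measurable_coe hmeas.compl)]
    filter_upwards [hP.counting, hdisc] with ω hω hωd
    exact hω.ae_le_join hmeas fun ξ hξ _ => hωd.mono hξ
  filter_upwards [hbf, himp] with ξ h1 h2 using ⟨h1, h2 h1⟩

/-- The variance identity, as an equality in `[0, ∞]`. -/
theorem lintegral_ofReal_sub_sq_add {Ω : Type*} [MeasurableSpace Ω] {m : Measure Ω}
    [IsProbabilityMeasure m] {f : Ω → ℝ≥0∞} (hf : Measurable f) (hfin : ∫⁻ x, f x ∂m ≠ ∞) :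
    ∫⁻ x, ENNReal.ofReal (((f x).toReal - (∫⁻ x, f x ∂m).toReal) ^ 2) ∂m + (∫⁻ x, f x ∂m) ^ 2
      = ∫⁻ x, f x ^ 2 ∂m := by
  set a := ∫⁻ x, f x ∂m with ha
  -- The cross term is moved to the left to avoid truncated subtraction. Only the mean must be
  -- finite, so an infinite second moment is covered.
  have hpt : ∀ᵐ x ∂m, ENNReal.ofReal (((f x).toReal - a.toReal) ^ 2) + 2 * a * f x
      = f x ^ 2 + a ^ 2 := by
    filter_upwards [ae_lt_top hf hfin] with x hx
    obtain ⟨u, hu⟩ : ∃ u : NNReal, (u : ℝ≥0∞) = f x := ⟨_, ENNReal.coe_toNNReal hx.ne⟩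
    obtain ⟨b, hb⟩ : ∃ b : NNReal, (b : ℝ≥0∞) = a := ⟨_, ENNReal.coe_toNNReal hfin⟩
    rw [← hu, ← hb]
    simp only [ENNReal.coe_toReal]
    rw [ENNReal.ofReal, ← ENNReal.coe_ofNat]
    norm_cast
    apply NNReal.coe_injective
    push_cast
    rw [Real.coe_toNNReal _ (sq_nonneg _)]
    ring
  have hint := lintegral_congr_ae hpt
  rw [lintegral_add_right _ (hf.const_mul _), lintegral_const_mul _ hf,
    lintegral_add_right _ measurable_const, ← ha] at hint
  simp only [lintegral_const, measure_univ, mul_one] at hint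
  have h2 : 2 * a * a = a ^ 2 + a ^ 2 := by ring
  rw [h2, ← add_assoc] at hint
  exact (ENNReal.add_left_inj (ENNReal.pow_ne_top hfin)).1 hint

theorem mainTheorem10 {X : Type*} [MetricSpace X] [CompleteSpace X]
    [TopologicalSpace.SeparableSpace X] [MeasurableSpace X] [BorelSpace X]
    -- the conservative ergodic infinite measure preserving system
    (μ : Measure X) (hμ_fin : BoundedlyFinite μ) (hμ_cont : NullSingletonClass μ) (hμ_inf : μ Set.univ = ∞)
    (T : X ≃ᵐ X) (hT : Ergodic T μ) (hT_cons : Conservative T μ)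
    -- the distribution of the random measure
    (m : Measure (Measure X)) (hm_prob : IsProbabilityMeasure m)
    (hm_fin : ∀ᵐ ξ ∂m, BoundedlyFinite ξ)
    (hm_erg : Ergodic (pushMeasure T) m)
    (hm_sq : ∀ B : Set X, MeasurableSet B → Bornology.IsBounded B → ∫⁻ ξ, ξ B ^ 2 ∂m < ∞)
    (hm_id : InfinitelyDivisible m)
    (hm_int : ∀ A : Set X, MeasurableSet A → ∫⁻ ξ, ξ A ∂m = μ A)
    (hm_disc : ∀ᵐ ξ ∂m, DiscreteMeasure ξ)
    (γ : Measure X) (ρ : Measure (Measure X)) (hm_rep : HasLevyRepresentation m γ ρ) :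
    γ = 0 ∧
    (MeasurePreserving (pushMeasure T) ρ ρ ∧ ∀ᵐ ξ ∂ρ, BoundedlyFinite ξ ∧ DiscreteMeasure ξ) ∧
    (∀ A : Set X, MeasurableSet A → μ A < ∞ → ∫⁻ ξ, ξ A ∂ρ = μ A) ∧
    (∀ A : Set X, MeasurableSet A → μ A < ∞ →
      ∫⁻ ξ, ξ A ^ 2 ∂ρ = ∫⁻ ξ, ENNReal.ofReal (((ξ A).toReal - (μ A).toReal) ^ 2) ∂m) ∧
    (∀ K : Set (Measure X), MeasurableSet K → pushMeasure T ⁻¹' K =ᵐ[ρ] K → ρ K < ∞ → ρ K = 0) := by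
  obtain ⟨P, hP, hmP⟩ := hm_rep.law
  have := hm_rep.sigmaFinite
  have := hμ_fin.sigmaFinite
  have := hP.isProbabilityMeasure
  obtain rfl : γ = 0 := hP.drift_eq_zero hmP hm_int hm_disc
  have hρ_ne : ∀ᵐ ξ ∂ρ, ξ ≠ 0 := hm_rep.carrier.mono fun ξ h => h.2
  simp only [zero_add] at hmP
  subst hmP
  have hint (A : Set X) (hA : MeasurableSet A) : ∫⁻ ξ, ξ A ∂ρ = μ A := by
    rw [← hm_int A hA, hP.lintegral_apply_map_join hA]
  have hjoin : Measure.join ρ = μ := by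
    ext A hA
    rw [Measure.join_apply hA, hint A hA]
  -- A strictly positive `μ`-integrable `w`; because `join ρ = μ`, `ξ ↦ ∫ w dξ` is `ρ`-integrable.
  obtain ⟨w, hw_pos, hw, hw_int⟩ := exists_pos_lintegral_lt_of_sigmaFinite μ one_ne_zero
  have hw' : Measurable fun x => (w x : ℝ≥0∞) := hw.coe_nnreal_ennreal
  have hw_ne (x : X) : (w x : ℝ≥0∞) ≠ 0 := ENNReal.coe_ne_zero.2 (hw_pos x).ne'
  have hw_top : ∫⁻ ξ, ∫⁻ x, (w x : ℝ≥0∞) ∂ξ ∂ρ ≠ ∞ := by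
    rw [← Measure.lintegral_join hw'.aemeasurable, hjoin]
    exact hw_int.ne_top
  have hTρ : MeasurePreserving (pushMeasure T) ρ ρ :=
    hP.measurePreserving_pushMeasure T hm_erg.toMeasurePreserving hρ_ne hw' hw_ne hw_top
  refine ⟨rfl, ⟨hTρ, hP.ae_boundedlyFinite_discreteMeasure
    (hm_rep.carrier.mono fun ξ h => h.1)
    (ae_of_ae_map Measure.measurable_join.aemeasurable hm_disc)⟩, fun A hA _ => hint A hA,
    fun A hA hμA => ?_, fun K hK hKT hρK =>
      hP.measure_eq_zero_of_invariant T hm_erg hTρ hρ_ne hw' hw_ne hw_top hK hKT hρK⟩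
  have hvar := lintegral_ofReal_sub_sq_add (m := P.map Measure.join)
    (Measure.measurable_coe hA) (by rw [hm_int A hA]; exact hμA.ne)
  rw [hP.lintegral_apply_sq_map_join hA, hint A hA, hm_int A hA] at hvar
  exact ((ENNReal.add_left_inj (ENNReal.pow_ne_top hμA.ne)).1 hvar).symm
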